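/- **Setting.** Let $0<b<\frac1{\sqrt2}$ and $\mu>0$. Let $M=\mathbb R\times[-1,1]$ with $(t,-1)\equiv(t,1)$ be the cylinder, $\mathcal F=C_c^\infty(M,\mathbb C)$, and $\mathcal I_b=\{n\in\mathbb Z:|n|<\frac1{\sqrt2\,b}\}$. For $\operatorname{Re}\tau\ge 0$ put $$g(\tau,x)=-\tfrac{\pi\tau}{2}-\tfrac12\log(1-e^{-\pi\tau+\pi i x})-\tfrac12\log(1-e^{-\pi\tau-\pi i x})$$ (principal branch; undefined at $\tau=it$ with $t+x\in2\mathbb Z$ or $t-x\in2\mathbb Z$). Let $k\ge1$, $n_1,\dots,n_k\in\mathcal I_b$, $\alpha_j=bn_j$, $w=-\sum_jn_j$, and $u_j=(t_j,x_j)\in M$. If $w<0$, put $C^{\mathrm L}_{bn_1,\dots,bn_k}=0$. If $w\ge0$ and no $u_j-u_{j'}=(t,x)$ with $j<j'$ satisfies $t+x\in2\mathbb Z$ or $t-x\in2\mathbb Z$, put $v_j=(it_j,x_j)$ and $$C^{\mathrm L}_{bn_1,\dots,bn_k}(u_1,\dots,u_k)=\frac{(-\mu)^w}{w!}\,e^{-4\sum_{j<j'}\alpha_j\alpha_{j'}g(\mathcal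 T(v_j-v_{j'}))}\int_{M_\gamma^w}e^{-4b\sum_{j,l}\alpha_jg(\mathcal T(v_j-U_l))-4b^2\sum_{l<l'}g(\mathcal T(U_l-U_{l'}))}\,dU_1\cdots dU_w ,$$ where $\gamma$ is the contour that runs horizontally from $it_1-\infty$ to $it_1$, then vertically to $it_2,it_3,\dots,it_k$ in this order, then horizontally to $it_k+\infty$; $M_\gamma=\gamma\times[-1,1]$, with $dU=\gamma'(s)\,ds\,dx$ for $U=(\gamma(s),x)$; and $\mathcal T(U-U')$ is the later point minus the earlier point in the order along $\gamma$, the $v_j$ being regarded as visited at the successive vertices of $\gamma$ in the order of their labels. (A $0$-fold integral is $1$, and values on null sets are irrelevant.) Let $\mathcal A$ be the tensor algebra of $\mathcal G=\bigoplus_{n\in\mathcal I_b}\mathcal G_n$, where $\mathcal G_n=\{\mathcal O_{f,n}:f\in\mathcal F\}$ is a copy of $\mathcal F$. Let $A\mapsto A^*$ be the conjugate-linear, anti-multiplicative, unital map of $\mathcal A$ with $\mathcal O_{f,n}^*=\mathcal O_{\bar f,n}$. Let $\omega:\mathcal A\to\mathbb C$ be the linear functional with $\omega(1)=1$ and $$\omega(\mathcal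 O_{f_1,n_1}\cdots\mathcal O_{f_k,n_k})=\int_{M^k}\prod_{j=1}^kf_j(u_j)\,C^{\mathrm L}_{bn_1,\dots,bn_k}(u_1,\dots,u_k)\,du_1\cdots du_k$$ (these integrals converge absolutely). Put $\langle A,B\rangle_{\mathcal A}=\omega(A^*B)$ and $\Phi(A)=(\omega(B^*A))_{B\in\mathcal A}\in\mathbb C^{\mathcal A}$. Let $\mathcal H_0=\Phi(\mathcal A)$, and let $\mathcal H$ be the closure of $\mathcal H_0$ in $\mathbb C^{\mathcal A}$ with the product topology. **Theorem (Properties of the state space).** The space $\mathcal H_0$ is dense in $\mathcal H$, and the formula $$(\Phi(A),z):=z_A\qquad(A\in\mathcal A,\ z=(z_B)_{B\in\mathcal A}\in\mathcal H)$$ defines a well-defined sesquilinear pairing on $\mathcal H_0\times\mathcal H$, conjugate linear in the first argument and linear in the second. For $A,B\in\mathcal A$, $(\Phi(A),\Phi(B))=\langle A,B\rangle_{\mathcal A}$. The restriction of the pairing to $\mathcal H_0\times\mathcal H_0$ is a nondegenerate Hermitian form. More generally, if $z\in\mathcal H$ and $(u,z)=0$ for all $u\in\mathcal H_0$, then $z=0$.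 -/

import Mathlib

open scoped ContDiff DirectSum TensorProduct

namespace TimelikeLiouville

noncomputable section

/-! ### Lorentzian correlators on the cylinder

Points of the cylinder `M = ℝ × ℝ/2ℤ` are written as pairs `(t, x)` with `t` the time and `x` a
lift of the spatial coordinate; the fundamental domain is `ℝ × [-1, 1]`. -/

/-- The Green's function of the cylinder, continued in the time variable to `0 ≤ Re τ`
(`Complex.log` is the principal branch). -/
def green (τ : ℂ) (x : ℝ) : ℂ :=
  -(Real.pi * τ) / 2
    - 1 / 2 * Complex.log (1 - Complex.exp (-(Real.pi * τ) + Real.pi * Complex.I * x))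
    - 1 / 2 * Complex.log (1 - Complex.exp (-(Real.pi * τ) - Real.pi * Complex.I * x))

/-- `g(𝒯(u - u'))` for points `u`, `u'` having contour parameters `s`, `s'`: the Green's function
at the difference "later minus earlier" along the contour. -/
def orderedGreen (s : ℝ) (u : ℂ × ℝ) (s' : ℝ) (u' : ℂ × ℝ) : ℂ :=
  if s < s' then green (u'.1 - u.1) (u'.2 - u.2) else green (u.1 - u'.1) (u.2 - u'.2)

/-- The contour coming in horizontally from `i t₀ - ∞` to `i t₀`, moving vertically to
`i t₁, i t₂, …, i t_k` in this order, and leaving horizontally to `i t_k + ∞`. It is parametrized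
so that `i t_j` is visited at the parameter value `j`, with unit speed on the horizontal pieces and
affinely on each `[j, j + 1]`. -/
def contour {k : ℕ} (t : Fin (k + 1) → ℝ) (s : ℝ) : ℂ :=
  ((min s 0 + max (s - k) 0 : ℝ) : ℂ)
    + Complex.I *
      ((t 0 + ∑ j : Fin k, (t j.succ - t j.castSucc) * max 0 (min 1 (s - (j : ℕ))) : ℝ) : ℂ)

/-- The Lorentzian correlator of the vertex operators with charges `α j` at the points `q j`, with
`w` screening insertions (to be used with `w = -b⁻¹ ∑ j, α j`), as an integral over the `w`-th power
of the tube `contour × [-1, 1]`. The external insertion with label `j` has contour parameter `j`. -/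
def lorentzCorrelator (b μ : ℝ) {k : ℕ} (α : Fin (k + 1) → ℂ) (w : ℕ)
    (q : Fin (k + 1) → ℝ × ℝ) : ℂ :=
  let γ : ℝ → ℂ := contour fun j => (q j).1
  let v : Fin (k + 1) → ℂ × ℝ := fun j => (Complex.I * (q j).1, (q j).2)
  (-(μ : ℂ)) ^ w / (w.factorial : ℂ)
    * Complex.exp (-4 * ∑ j, ∑ j' ∈ Finset.Ioi j,
        α j * α j' * orderedGreen (j : ℕ) (v j) (j' : ℕ) (v j'))
    * ∫ y in Set.univ.pi (fun _ : Fin w => Set.Icc (-1 : ℝ) 1), ∫ s : Fin w → ℝ,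
        Complex.exp
          (-4 * b * ∑ j, ∑ l, α j * orderedGreen (j : ℕ) (v j) (s l) (γ (s l), y l)
            - 4 * b ^ 2 * ∑ l, ∑ l' ∈ Finset.Ioi l,
                orderedGreen (s l) (γ (s l), y l) (s l') (γ (s l'), y l'))
        * ∏ l, deriv γ (s l)

/-- The correlator for charges `b n_j` with integers `n_j`. The screening number is
`w = -∑ j, n_j`, and the correlator vanishes when `w < 0`. -/
def integerCorrelator (b μ : ℝ) {k : ℕ} (n : Fin (k + 1) → ℤ) (q : Fin (k + 1) → ℝ × ℝ) : ℂ :=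
  if -∑ j, n j < 0 then 0
  else lorentzCorrelator b μ (fun j => (b : ℂ) * (n j : ℂ)) (-∑ j, n j).toNat q

/-! ### Smeared observables -/

/-- `C_c^∞(M, ℂ)` for the cylinder `M`: smooth functions of `(t, x)` of period `2` in `x` that
vanish for large `|t|`. -/
def TestFunction : Submodule ℂ (ℝ × ℝ → ℂ) where
  carrier := {f | ContDiff ℝ ∞ f ∧ (∀ t x, f (t, x + 2) = f (t, x)) ∧
    ∃ R : ℝ, ∀ t x, R < |t| → f (t, x) = 0}
  zero_mem' := ⟨contDiff_const, fun _ _ => rfl, 0, fun _ _ _ => rfl⟩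
  add_mem' := by
    rintro f g ⟨hf, hf2, R, hR⟩ ⟨hg, hg2, S, hS⟩
    refine ⟨hf.add hg, fun t x => by simp [hf2 t x, hg2 t x], max R S, fun t x h => ?_⟩
    simp [hR t x ((le_max_left _ _).trans_lt h), hS t x ((le_max_right _ _).trans_lt h)]
  smul_mem' := by
    rintro c f ⟨hf, hf2, R, hR⟩
    exact ⟨contDiff_const.smul hf, fun t x => by simp [hf2 t x], R,
      fun t x h => by simp [hR t x h]⟩

/-- Pointwise complex conjugation of test functions. -/
def testConj (f : TestFunction) : TestFunction :=
  ⟨fun u => starRingEnd ℂ (f.1 u), by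
    obtain ⟨f, hf, hf2, R, hR⟩ := f
    exact ⟨Complex.conjCLE.contDiff.comp hf, fun t x => by simp [hf2 t x], R,
      fun t x h => by simp [hR t x h]⟩⟩

/-- The admissible integer charges `ℐ_b`. -/
abbrev ChargeIndex (b : ℝ) : Type := {n : ℤ // |(n : ℝ)| < 1 / (Real.sqrt 2 * b)}

/-- Lebesgue measure on `M ^ (k + 1)`, each factor being represented by `ℝ × [-1, 1]`. -/
def cylinderMeasure (k : ℕ) : MeasureTheory.Measure (Fin (k + 1) → ℝ × ℝ) :=
  MeasureTheory.volume.restrict (Set.univ.pi fun _ => Set.univ ×ˢ Set.Icc (-1 : ℝ) 1)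

/-- The integrand `∏ j, f_j(u_j) C_{bn}(u_1, …)` of the smeared vacuum expectation value. -/
def smearedIntegrand (b μ : ℝ) {k : ℕ} (n : Fin (k + 1) → ℤ) (f : Fin (k + 1) → TestFunction)
    (u : Fin (k + 1) → ℝ × ℝ) : ℂ :=
  (∏ j, (f j).1 (u j)) * integerCorrelator b μ n u

theorem smearedIntegrand_update_add (b μ : ℝ) {k : ℕ} (n : Fin (k + 1) → ℤ)
    [DecidableEq (Fin (k + 1))] (f : Fin (k + 1) → TestFunction) (i : Fin (k + 1))
    (x y : TestFunction) :
    smearedIntegrand b μ n (Function.update f i (x + y)) = fun u =>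
      smearedIntegrand b μ n (Function.update f i x) u
        + smearedIntegrand b μ n (Function.update f i y) u := by
  funext u
  have h (z : TestFunction) : (∏ j, (Function.update f i z j).1 (u j))
      = z.1 (u i) * ∏ j ∈ Finset.univ.erase i, (f j).1 (u j) := by
    rw [← Finset.mul_prod_erase Finset.univ _ (Finset.mem_univ i), Function.update_self]
    congr 1
    refine Finset.prod_congr rfl fun j hj => ?_
    rw [Function.update_of_ne (Finset.ne_of_mem_erase hj)]
  simp only [smearedIntegrand, h]
  simp only [Submodule.coe_add, Pi.add_apply]
  ring

theorem smearedIntegrand_update_smul (b μ : ℝ) {k : ℕ} (n : Fin (k + 1) → ℤ)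
    [DecidableEq (Fin (k + 1))] (f : Fin (k + 1) → TestFunction) (i : Fin (k + 1))
    (c : ℂ) (x : TestFunction) :
    smearedIntegrand b μ n (Function.update f i (c • x)) = fun u =>
      c * smearedIntegrand b μ n (Function.update f i x) u := by
  funext u
  have h (z : TestFunction) : (∏ j, (Function.update f i z j).1 (u j))
      = z.1 (u i) * ∏ j ∈ Finset.univ.erase i, (f j).1 (u j) := by
    rw [← Finset.mul_prod_erase Finset.univ _ (Finset.mem_univ i), Function.update_self]
    congr 1
    refine Finset.prod_congr rfl fun j hj => ?_
    rw [Function.update_of_ne (Finset.ne_of_mem_erase hj)]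
  simp only [smearedIntegrand, h]
  simp only [Submodule.coe_smul, Pi.smul_apply, smul_eq_mul]
  ring

/-- Absolute convergence of the smeared integrals with charges `b n_j`, for all test functions. -/
def SmearingConverges (b μ : ℝ) {k : ℕ} (n : Fin (k + 1) → ℤ) : Prop :=
  ∀ f : Fin (k + 1) → TestFunction,
    MeasureTheory.Integrable (smearedIntegrand b μ n f) (cylinderMeasure k)

open Classical in
/-- The smeared vacuum expectation value
`⟨𝒪_{f₀,n₀} ⋯ 𝒪_{f_k,n_k}⟩ = ∫ ∏ j, f_j(u_j) C_{bn}(u₀, …, u_k) du₀ ⋯ du_k`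
as a multilinear form in the test functions. As for the Bochner integral itself, the value is
`0` by convention where the integrals are not absolutely convergent. -/
def smearedVev (b μ : ℝ) {k : ℕ} (n : Fin (k + 1) → ℤ) :
    MultilinearMap ℂ (fun _ : Fin (k + 1) => TestFunction) ℂ :=
  if h : SmearingConverges b μ n then
    { toFun := fun f => ∫ u, smearedIntegrand b μ n f u ∂cylinderMeasure k
      map_update_add' := fun f i x y => by
        rw [smearedIntegrand_update_add]
        exact MeasureTheory.integral_add (h _) (h _)
      map_update_smul' := fun f i c x => by
        rw [smearedIntegrand_update_smul]
        exact MeasureTheory.integral_const_mul _ _ }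
  else 0

theorem smearedVev_apply {b μ : ℝ} {k : ℕ} {n : Fin (k + 1) → ℤ} (h : SmearingConverges b μ n)
    (f : Fin (k + 1) → TestFunction) :
    smearedVev b μ n f
      = ∫ u, (∏ j, (f j).1 (u j)) * integerCorrelator b μ n u ∂cylinderMeasure k := by
  rw [smearedVev, dif_pos h]
  rfl

/-! ### The ordered algebra and the vacuum functional -/

/-- The space of generators `𝒢 = ⨁_{n ∈ ℐ_b} 𝒢_n`, each `𝒢_n` a copy of the test functions. -/
abbrev Generators (b : ℝ) : Type := ⨁ _ : ChargeIndex b, TestFunction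

/-- The ordered observable algebra `𝒜 = T(𝒢)`. -/
abbrev ObsAlgebra (b : ℝ) : Type := TensorAlgebra ℂ (Generators b)

/-- The basic smeared observable `𝒪_{f,n}` as a generator. -/
def gen {b : ℝ} (f : TestFunction) (n : ChargeIndex b) : Generators b :=
  DirectSum.lof ℂ (ChargeIndex b) (fun _ => TestFunction) n f

/-- The basic smeared observable `𝒪_{f,n}` as an element of `𝒜`. -/
def obs {b : ℝ} (f : TestFunction) (n : ChargeIndex b) : ObsAlgebra b :=
  TensorAlgebra.ι ℂ (gen f n)

/-- The vacuum functional on words of a given length, as a multilinear form in the generators. -/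
def vacuumWord (b μ : ℝ) : (k : ℕ) → MultilinearMap ℂ (fun _ : Fin k => Generators b) ℂ
  | 0 => MultilinearMap.constOfIsEmpty ℂ _ 1
  | k + 1 => MultilinearMap.fromDirectSumEquiv (R := ℂ) (M' := ℂ) (κ := fun _ : Fin (k + 1) => ChargeIndex b)
      (M := fun _ _ => TestFunction) fun n => smearedVev b μ fun j => (n j : ℤ)

/-- The vacuum functional `ω : 𝒜 → ℂ`. -/
def vacuum (b μ : ℝ) : ObsAlgebra b →ₗ[ℂ] ℂ :=
  DirectSum.toModule ℂ ℕ ℂ (fun k => PiTensorProduct.lift (vacuumWord b μ k))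
    ∘ₗ (TensorAlgebra.toDirectSum (R := ℂ) (M := Generators b)).toLinearMap

theorem vacuum_tprod (b μ : ℝ) (k : ℕ) (g : Fin k → Generators b) :
    vacuum b μ (TensorAlgebra.tprod ℂ (Generators b) k g) = vacuumWord b μ k g := by
  rw [vacuum, LinearMap.comp_apply, AlgHom.toLinearMap_apply,
    TensorAlgebra.toDirectSum_tensorPower_tprod, ← DirectSum.lof_eq_of ℂ, DirectSum.toModule_lof,
    PiTensorProduct.lift.tprod]

theorem vacuum_one (b μ : ℝ) : vacuum b μ 1 = 1 := by
  have h := vacuum_tprod b μ 0 Fin.elim0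
  simpa [vacuumWord] using h

/-- `ω` takes the expected values on monomials. -/
theorem vacuum_monomial (b μ : ℝ) (k : ℕ) (f : Fin (k + 1) → TestFunction)
    (n : Fin (k + 1) → ChargeIndex b) :
    vacuum b μ (List.ofFn fun j => obs (f j) (n j)).prod
      = smearedVev b μ (fun j => (n j : ℤ)) f := by
  have h := vacuum_tprod b μ (k + 1) fun j => gen (f j) (n j)
  rw [TensorAlgebra.tprod_apply] at h
  refine h.trans ?_
  exact MultilinearMap.fromDirectSumEquiv_lof (R := ℂ) (M' := ℂ) (κ := fun _ : Fin (k + 1) => ChargeIndex b)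
    (M := fun _ _ => TestFunction) (fun n => smearedVev b μ fun j => (n j : ℤ)) n f

/-! ### The involution -/

/-- Conjugation of the generators: `𝒪_{f,n} ↦ 𝒪_{f̄,n}`. -/
def genConj (b : ℝ) : Generators b →+ Generators b :=
  DirectSum.map fun _ =>
    { toFun := testConj
      map_zero' := Subtype.ext (funext fun _ => map_zero (starRingEnd ℂ))
      map_add' := fun _ _ => Subtype.ext (funext fun _ => map_add (starRingEnd ℂ) _ _) }

theorem genConj_gen {b : ℝ} (f : TestFunction) (n : ChargeIndex b) :
    genConj b (gen f n) = gen (testConj f) n := by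
  simp only [genConj, gen, DirectSum.lof_eq_of]
  rw [DirectSum.map_of]
  rfl

theorem genConj_smul {b : ℝ} (c : ℂ) (g : Generators b) :
    genConj b (c • g) = starRingEnd ℂ c • genConj b g := by
  refine DFinsupp.ext fun n => Subtype.ext (funext fun u => ?_)
  exact map_mul (starRingEnd ℂ) _ _

/-- The opposite algebra of `𝒜` with the complex conjugate scalar multiplication, so that
conjugate-linear anti-homomorphisms of `𝒜` are algebra homomorphisms into it. -/
def ConjOpposite (b : ℝ) : Type := (ObsAlgebra b)ᵐᵒᵖ

instance (b : ℝ) : Ring (ConjOpposite b) := inferInstanceAs (Ring (ObsAlgebra b)ᵐᵒᵖ)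

instance (b : ℝ) : Algebra ℂ (ConjOpposite b) :=
  RingHom.toAlgebra' ((algebraMap ℂ (ObsAlgebra b)ᵐᵒᵖ).comp (starRingEnd ℂ))
    fun c x => Algebra.commutes (A := (ObsAlgebra b)ᵐᵒᵖ) (starRingEnd ℂ c) x

/-- The generators, conjugated, inside the conjugate opposite algebra. -/
def genConjOpposite (b : ℝ) : Generators b →ₗ[ℂ] ConjOpposite b where
  toFun g := MulOpposite.op (TensorAlgebra.ι ℂ (genConj b g))
  map_add' g h := by
    rw [map_add, map_add]
    rfl
  map_smul' c g := by
    rw [genConj_smul, map_smul, Algebra.smul_def, Algebra.commutes]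
    exact (Algebra.smul_def (A := ConjOpposite b) c
      (MulOpposite.op (TensorAlgebra.ι ℂ (genConj b g)))).symm

/-- The involution `A ↦ A^*`: the conjugate-linear, anti-multiplicative extension of
`𝒪_{f,n} ↦ 𝒪_{f̄,n}`. -/
def adj {b : ℝ} (A : ObsAlgebra b) : ObsAlgebra b :=
  MulOpposite.unop (α := ObsAlgebra b) (TensorAlgebra.lift ℂ (genConjOpposite b) A)

theorem adj_obs {b : ℝ} (f : TestFunction) (n : ChargeIndex b) :
    adj (obs f n) = obs (testConj f) n := by
  rw [adj, obs, TensorAlgebra.lift_ι_apply, obs, ← genConj_gen]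
  rfl

theorem adj_one (b : ℝ) : adj (1 : ObsAlgebra b) = 1 := by
  rw [adj, map_one]
  rfl

theorem adj_mul {b : ℝ} (A B : ObsAlgebra b) : adj (A * B) = adj B * adj A := by
  rw [adj, map_mul]
  rfl

theorem adj_add {b : ℝ} (A B : ObsAlgebra b) : adj (A + B) = adj A + adj B := by
  rw [adj, map_add]
  rfl

theorem adj_smul {b : ℝ} (c : ℂ) (A : ObsAlgebra b) :
    adj (c • A) = starRingEnd ℂ c • adj A := by
  rw [adj, map_smul, Algebra.smul_def, Algebra.smul_def, Algebra.commutes]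
  rfl

/-- The sesquilinear form `⟨A, B⟩_𝒜 = ω(A^* B)`. -/
def algForm (b μ : ℝ) (A B : ObsAlgebra b) : ℂ := vacuum b μ (adj A * B)

/-! ### The state space -/

/-- The map `Φ : 𝒜 → ℂ^𝒜`, `Φ(A) = (ω(B^* A))_B`. -/
def Phi (b μ : ℝ) : ObsAlgebra b →ₗ[ℂ] (ObsAlgebra b → ℂ) where
  toFun A := fun B => vacuum b μ (adj B * A)
  map_add' A A' := by
    funext B
    simp [mul_add]
  map_smul' c A := by
    funext B
    simp

/-- `ℋ₀ = Φ(𝒜)`. -/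
def stateCore (b μ : ℝ) : Submodule ℂ (ObsAlgebra b → ℂ) := LinearMap.range (Phi b μ)

/-- `ℋ`, the closure of `ℋ₀` in `ℂ^𝒜` with the product topology. -/
def stateSpace (b μ : ℝ) : Submodule ℂ (ObsAlgebra b → ℂ) := (stateCore b μ).topologicalClosure

/-- The inclusion of `ℋ₀` into `ℋ`. -/
def coreIncl (b μ : ℝ) : stateCore b μ →ₗ[ℂ] stateSpace b μ :=
  Submodule.inclusion (stateCore b μ).le_topologicalClosure

/-- `Φ(A)` as an element of `ℋ₀`. -/
def coreVec (b μ : ℝ) (A : ObsAlgebra b) : stateCore b μ := ⟨Phi b μ A, A, rfl⟩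

end

end TimelikeLiouville

open TimelikeLiouville

namespace TimelikeLiouville

/-! ### Time reflection of the correlators -/

/-! The only analytic input is Hermiticity of the vacuum functional, `vacuum_adj`: ω(A^*) is the
conjugate of ω(A). The reflection τ ↦ -τ̄ fixes the imaginary axis and carries the contour through
it_1, …, it_k to the contour through the reversed points, traversed backwards. It conjugates each
difference "later minus earlier", and g(τ̄, x) is the conjugate of g(τ, x). Since b, μ and the
charges are real, reversing the insertions conjugates the correlator (`lorentzCorrelator_reflect`);
smearing and linearity extend this to the algebra.

Hence Φ(A)_B is the conjugate of Φ(B)_A (`Phi_conj_symm`). On Φ(C) the coordinate z_A therefore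
depends only on Φ(A), and by continuity of coordinates this persists on the closure
(`stateSpace_eval_eq`); conjugate linearity in A passes to the closure likewise. The pairing
separates points because its values are all the coordinates of z. -/

theorem log_one_sub_exp_conj {z : ℂ} (hz : z.re ≤ 0) :
    Complex.log (1 - Complex.exp (starRingEnd ℂ z))
      = starRingEnd ℂ (Complex.log (1 - Complex.exp z)) := by
  rw [← Complex.log_conj, map_sub, map_one, Complex.exp_conj]
  -- An argument π would force a negative real part, but |exp z| ≤ 1 gives Re (1 - exp z) ≥ 0.
  intro h
  rw [Complex.arg_eq_pi_iff] at h
  have h1 := (Complex.re_le_norm _).trans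
    ((Complex.norm_exp z).le.trans (Real.exp_le_one_iff.2 hz))
  have h2 := h.1
  rw [Complex.sub_re, Complex.one_re] at h2
  linarith

/-- Conjugation interchanges the two logarithms; Re τ ≥ 0 keeps both off the branch cut. -/
theorem green_conj {τ : ℂ} (hτ : 0 ≤ τ.re) (x : ℝ) :
    green (starRingEnd ℂ τ) x = starRingEnd ℂ (green τ x) := by
  have key (y : ℝ) : Complex.log (1 - Complex.exp
      (-(Real.pi * starRingEnd ℂ τ) - Real.pi * Complex.I * y)) = starRingEnd ℂ
        (Complex.log (1 - Complex.exp (-(Real.pi * τ) + Real.pi * Complex.I * y))) := by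
    rw [← log_one_sub_exp_conj]
    · congr 3
      simp [sub_eq_add_neg]
    · simpa using mul_nonneg Real.pi_pos.le hτ
  have h1 := key x
  have h2 := key (-x)
  simp only [Complex.ofReal_neg, mul_neg, sub_neg_eq_add, ← sub_eq_add_neg] at h2
  simp only [green, map_sub, map_mul, map_div₀, map_neg, ← h1, ← h2, Complex.conj_ofReal, map_one,
    map_ofNat]
  ring

theorem green_neg (τ : ℂ) (x : ℝ) : green τ (-x) = green τ x := by
  simp only [green, Complex.ofReal_neg, mul_neg, sub_neg_eq_add, ← sub_eq_add_neg]
  ring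

/-- The reflection `τ ↦ -τ̄` of complexified time. -/
noncomputable def timeReflect (u : ℂ × ℝ) : ℂ × ℝ := (-starRingEnd ℂ u.1, u.2)

/-- The map s ↦ c - s exchanges earlier and later, and (-ū) - (-ū') is the conjugate of u' - u. The
monotonicity hypotheses keep the differences in Re τ ≥ 0. At equal parameters the default branch is
used on both sides, so the times must agree and evenness in x finishes. -/
theorem orderedGreen_reflect {s s' : ℝ} {u u' : ℂ × ℝ} (c : ℝ)
    (h : s < s' → u.1.re ≤ u'.1.re) (h' : s' < s → u'.1.re ≤ u.1.re) (h0 : s = s' → u.1 = u'.1) :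
    orderedGreen (c - s) (timeReflect u) (c - s') (timeReflect u')
      = starRingEnd ℂ (orderedGreen s u s' u') := by
  have aux (a a' : ℂ × ℝ) (ha : a.1.re ≤ a'.1.re) :
      green ((timeReflect a).1 - (timeReflect a').1) ((timeReflect a).2 - (timeReflect a').2)
        = starRingEnd ℂ (green (a'.1 - a.1) (a'.2 - a.2)) := by
    rw [← green_conj (by simpa using ha), ← green_neg]
    congr 1
    · simp [timeReflect]; ring
    · simp [timeReflect]
  unfold orderedGreen
  rcases lt_trichotomy s s' with hs | hs | hs
  · rw [if_neg (by linarith), if_pos hs, aux _ _ (h hs)]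
  · rw [if_neg (by linarith), if_neg (by linarith), aux _ _ (by rw [h0 hs]), ← green_neg]
    simp [h0 hs]
  · rw [if_pos (by linarith), if_neg (by linarith), aux _ _ (h' hs)]

theorem orderedGreen_comm {s s' : ℝ} (h : s ≠ s') (u u' : ℂ × ℝ) :
    orderedGreen s u s' u' = orderedGreen s' u' s u := by
  unfold orderedGreen
  rcases lt_or_gt_of_ne h with h | h
  · rw [if_pos h, if_neg h.not_gt]
  · rw [if_pos h, if_neg h.not_gt]

/-! ### Geometry of the contour -/

theorem contour_re {k : ℕ} (t : Fin (k + 1) → ℝ) (s : ℝ) :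
    (contour t s).re = min s 0 + max (s - k) 0 := by
  rw [contour, Complex.add_re, Complex.ofReal_re, Complex.I_mul_re, Complex.ofReal_im, neg_zero,
    add_zero]

theorem contour_re_mono {k : ℕ} (t : Fin (k + 1) → ℝ) : Monotone fun s => (contour t s).re := by
  intro s s' h
  simp only [contour_re]
  gcongr

theorem sum_increments_lt {k : ℕ} (t : Fin (k + 1) → ℝ) (j : Fin (k + 1)) :
    t 0 + ∑ i : Fin k, (t i.succ - t i.castSucc) * (if i.castSucc < j then 1 else 0) = t j := by
  induction j using Fin.induction with
  | zero => simp
  | succ j ih =>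
    have h (i : Fin k) : (if i.castSucc < j.succ then 1 else 0 : ℝ)
        = (if i.castSucc < j.castSucc then 1 else 0) + if i = j then 1 else 0 := by
      simp only [Fin.castSucc_lt_succ_iff, Fin.castSucc_lt_castSucc_iff]
      rcases lt_trichotomy i j with h | h | h
      · simp [h, h.le, h.ne]
      · simp [h]
      · simp [h.not_gt, h.not_ge, h.ne']
    simp only [h, mul_add, Finset.sum_add_distrib, ← add_assoc, ih]
    simp

theorem contour_natCast {k : ℕ} (t : Fin (k + 1) → ℝ) (j : Fin (k + 1)) :
    contour t (j : ℕ) = Complex.I * t j := by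
  have hj : ((j : ℕ) : ℝ) ≤ k := by exact_mod_cast Nat.lt_succ_iff.1 j.2
  have h (i : Fin k) : max 0 (min 1 (((j : ℕ) : ℝ) - (i : ℕ)))
      = if i.castSucc < j then 1 else 0 := by
    split_ifs with hi
    · have : ((i : ℕ) : ℝ) + 1 ≤ (j : ℕ) := by exact_mod_cast hi
      rw [min_eq_left (by linarith), max_eq_right zero_le_one]
    · have : ((j : ℕ) : ℝ) ≤ (i : ℕ) := by exact_mod_cast not_lt.1 hi
      exact max_eq_left ((min_le_right _ _).trans (by linarith))
  simp only [contour, h]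
  rw [sum_increments_lt, min_eq_right (Nat.cast_nonneg _), max_eq_right (by linarith)]
  simp

theorem contour_reflect {k : ℕ} (t : Fin (k + 1) → ℝ) (s : ℝ) :
    contour (fun j => t j.rev) (k - s) = -starRingEnd ℂ (contour t s) := by
  have hre : min ((k : ℝ) - s) 0 + max ((k : ℝ) - s - k) 0 = -(min s 0 + max (s - k) 0) := by
    have h1 : min ((k : ℝ) - s) 0 = -max (s - k) 0 := by
      rw [← neg_sub s, ← neg_zero, min_neg_neg, neg_zero]
    have h2 : max ((k : ℝ) - s - k) 0 = -min s 0 := by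
      rw [show (k : ℝ) - s - k = -s by ring, ← neg_zero, max_neg_neg, neg_zero]
    rw [h1, h2]; ring
  have hc (x : ℝ) : max 0 (min 1 (1 - x)) = 1 - max 0 (min 1 x) := by
    rcases le_total x 0 with h | h
    · rw [min_eq_left (by linarith), min_eq_right (by linarith), max_eq_left h]; norm_num
    · rcases le_total x 1 with h' | h'
      · rw [min_eq_right (by linarith), min_eq_right h', max_eq_right (by linarith),
          max_eq_right h]
      · rw [min_eq_right (by linarith), min_eq_left h', max_eq_left (by linarith)]; norm_num
  have him : t (Fin.rev 0) + ∑ j : Fin k, (t j.succ.rev - t j.castSucc.rev)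
        * max 0 (min 1 ((k : ℝ) - s - (j : ℕ)))
      = t 0 + ∑ j : Fin k, (t j.succ - t j.castSucc) * max 0 (min 1 (s - (j : ℕ))) := by
    have h1 : ∑ j : Fin k, (t j.succ.rev - t j.castSucc.rev)
          * max 0 (min 1 ((k : ℝ) - s - (j : ℕ)))
        -- Reindexing by j ↦ k - 1 - j negates each increment and turns the clamp at x = s - j into
        -- the clamp at 1 - x, which is one minus it. The leftover -1 terms telescope to t_0 - t_k.
        = ∑ j : Fin k, (t j.succ - t j.castSucc) * (max 0 (min 1 (s - (j : ℕ))) - 1) := by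
      rw [← Equiv.sum_comp Fin.revPerm]
      refine Finset.sum_congr rfl fun j _ => ?_
      have hj : ((j.rev : ℕ) : ℝ) = k - 1 - (j : ℕ) := by
        rw [Fin.val_rev, Nat.cast_sub j.2]
        push_cast; ring
      rw [Fin.revPerm_apply, hj, Fin.rev_succ, Fin.rev_castSucc, Fin.rev_rev,
        show (k : ℝ) - s - (k - 1 - (j : ℕ)) = 1 - (s - (j : ℕ)) by ring, hc]
      ring
    have h2 := sum_increments_lt t (Fin.last k)
    simp only [Fin.castSucc_lt_last, if_true] at h2
    rw [h1, Fin.rev_zero, ← h2]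
    simp only [mul_sub, Finset.sum_sub_distrib]
    ring
  simp only [contour, hre, him, map_add, map_mul, Complex.conj_ofReal, Complex.conj_I]
  push_cast
  ring

/-- The sign from s ↦ k - s cancels the sign in -γ̄. Both derivative rules hold without
differentiability, so corners need no exception. -/
theorem deriv_contour_reflect {k : ℕ} (t : Fin (k + 1) → ℝ) (s : ℝ) :
    deriv (contour fun j => t j.rev) (k - s) = starRingEnd ℂ (deriv (contour t) s) := by
  have h := deriv_comp_const_sub (f := contour fun j => t j.rev) (k : ℝ) s
  simp only [contour_reflect] at h
  rw [← neg_inj, ← h, deriv.fun_neg]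
  exact congrArg Neg.neg (deriv.star (f := contour t) (x := s))

/-! ### Conjugation of the correlators -/

theorem sum_Ioi_rev {k : ℕ} {M : Type*} [AddCommMonoid M] (F : Fin (k + 1) → Fin (k + 1) → M)
    (hF : ∀ i j, i ≠ j → F i j = F j i) :
    ∑ i : Fin (k + 1), ∑ j ∈ Finset.Ioi i, F i.rev j.rev = ∑ i, ∑ j ∈ Finset.Ioi i, F i j := by
  have h (G : Fin (k + 1) → Fin (k + 1) → M) :
      ∑ i, ∑ j ∈ Finset.Ioi i, G i j = ∑ i, ∑ j, if i < j then G i j else 0 := by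
    refine Finset.sum_congr rfl fun i _ => ?_
    rw [← Finset.sum_filter]
    congr 1
    ext; simp
  rw [h, h, Finset.sum_comm, ← Equiv.sum_comp Fin.revPerm]
  refine Finset.sum_congr rfl fun i _ => ?_
  rw [← Equiv.sum_comp Fin.revPerm]
  refine Finset.sum_congr rfl fun j _ => ?_
  simp only [Fin.revPerm_apply, Fin.rev_rev, Fin.rev_lt_rev]
  split_ifs with hij
  -- Only off-diagonal pairs occur; `orderedGreen` need not be symmetric at equal parameters.
  · exact hF _ _ hij.ne'
  · rfl

theorem integral_const_sub_pi {w : ℕ} (c : ℝ) (F : (Fin w → ℝ) → ℂ) :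
    ∫ s : Fin w → ℝ, F (fun l => c - s l) = ∫ s : Fin w → ℝ, F s :=
  MeasureTheory.integral_sub_left_eq_self F MeasureTheory.volume (fun _ : Fin w => c)

theorem lorentzCorrelator_reflect (b μ : ℝ) {k : ℕ} {α : Fin (k + 1) → ℂ}
    (hα : ∀ j, starRingEnd ℂ (α j) = α j) (w : ℕ) (q : Fin (k + 1) → ℝ × ℝ) :
    lorentzCorrelator b μ (fun j => α j.rev) w (fun j => q j.rev)
      = starRingEnd ℂ (lorentzCorrelator b μ α w q) := by
  set γ := contour fun j => (q j).1 with hγ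
  set γ' := contour fun j => (q j.rev).1 with hγ'
  have hrefl (s : ℝ) (y : ℝ) : (γ' (k - s), y) = timeReflect (γ s, y) :=
    Prod.ext (contour_reflect (fun j => (q j).1) s) rfl
  have hreflv (j : Fin (k + 1)) : (Complex.I * ((q j).1 : ℂ), (q j).2)
      = timeReflect (Complex.I * ((q j).1 : ℂ), (q j).2) := by
    simp [timeReflect]
  have hrev (j : Fin (k + 1)) : ((j.rev : ℕ) : ℝ) = k - (j : ℕ) := by
    rw [Fin.val_rev, Nat.add_sub_add_right, Nat.cast_sub (Nat.lt_succ_iff.1 j.2)]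
  -- External insertions lie on the contour, so monotonicity of Re γ also compares them with
  -- screening points.
  have hvert (j : Fin (k + 1)) : Complex.I * ((q j).1 : ℂ) = γ (j : ℕ) :=
    (contour_natCast (fun j => (q j).1) j).symm
  have hmono : Monotone fun s => (γ s).re := contour_re_mono _
  have hvv (j j' : Fin (k + 1)) :
      orderedGreen (j.rev : ℕ) (Complex.I * ((q j).1 : ℂ), (q j).2)
          (j'.rev : ℕ) (Complex.I * ((q j').1 : ℂ), (q j').2)
        = starRingEnd ℂ (orderedGreen (j : ℕ) (Complex.I * ((q j).1 : ℂ), (q j).2)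
          (j' : ℕ) (Complex.I * ((q j').1 : ℂ), (q j').2)) := by
    rw [hreflv j, hreflv j', hrev, hrev, orderedGreen_reflect, ← hreflv, ← hreflv]
    · simp
    · simp
    · intro h
      have : j = j' := Fin.ext (by exact_mod_cast h)
      rw [this]
  have hvs (j : Fin (k + 1)) (s y : ℝ) :
      orderedGreen (j.rev : ℕ) (Complex.I * ((q j).1 : ℂ), (q j).2) (k - s) (γ' (k - s), y)
        = starRingEnd ℂ (orderedGreen (j : ℕ) (Complex.I * ((q j).1 : ℂ), (q j).2) s
          (γ s, y)) := by
    rw [hreflv j, hrefl, hrev, orderedGreen_reflect, ← hreflv]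
    · intro h
      simp only [hvert]
      exact hmono h.le
    · intro h
      simp only [hvert]
      exact hmono h.le
    · intro h
      simp only [hvert, h]
  have hss (s y s' y' : ℝ) :
      orderedGreen (k - s) (γ' (k - s), y) (k - s') (γ' (k - s'), y')
        = starRingEnd ℂ (orderedGreen s (γ s, y) s' (γ s', y')) := by
    rw [hrefl, hrefl, orderedGreen_reflect _ (fun h => hmono h.le) (fun h => hmono h.le)]
    intro h
    simp only [h]
  unfold lorentzCorrelator
  simp only [← hγ, ← hγ']
  rw [map_mul, map_mul, ← Complex.exp_conj, ← integral_conj]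
  congr 1
  · congr 1
    · simp
    · have := sum_Ioi_rev (fun j j' => α j * α j' * starRingEnd ℂ
        (orderedGreen (j : ℕ) (Complex.I * ((q j).1 : ℂ), (q j).2)
          (j' : ℕ) (Complex.I * ((q j').1 : ℂ), (q j').2))) fun i j hij => by
        rw [orderedGreen_comm (by exact_mod_cast Fin.val_ne_of_ne hij), mul_comm (α i)]
      simp only [← hvv, Fin.rev_rev] at this
      simp only [this, map_mul, map_sum, map_neg, map_ofNat, hα, hvv]
  · refine MeasureTheory.integral_congr_ae (Filter.Eventually.of_forall fun y => ?_)
    simp only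
    -- Substitute s_l ↦ k - s_l. Screening labels stay fixed; only the external labels are reversed.
    rw [← integral_const_sub_pi k, ← integral_conj]
    refine MeasureTheory.integral_congr_ae (Filter.Eventually.of_forall fun s => ?_)
    simp only [map_mul, map_prod, ← Complex.exp_conj, map_sub, map_sum, map_neg, map_ofNat, hα,
      map_pow, Complex.conj_ofReal, ← hss, ← hvs]
    have h1 : ∑ j : Fin (k + 1), ∑ l, α j.rev * orderedGreen (j : ℕ)
          (Complex.I * ((q j.rev).1 : ℂ), (q j.rev).2) (k - s l) (γ' (k - s l), y l)
        = ∑ j : Fin (k + 1), ∑ l, α j * orderedGreen (j.rev : ℕ)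
          (Complex.I * ((q j).1 : ℂ), (q j).2) (k - s l) (γ' (k - s l), y l) := by
      rw [← Equiv.sum_comp Fin.revPerm]
      simp only [Fin.revPerm_apply, Fin.rev_rev]
    rw [h1]
    congr 1
    refine Finset.prod_congr rfl fun l _ => ?_
    exact deriv_contour_reflect (fun j => (q j).1) (s l)

theorem integerCorrelator_reflect (b μ : ℝ) {k : ℕ} (n : Fin (k + 1) → ℤ)
    (q : Fin (k + 1) → ℝ × ℝ) :
    integerCorrelator b μ (fun j => n j.rev) (fun j => q j.rev)
      = starRingEnd ℂ (integerCorrelator b μ n q) := by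
  have h : ∑ j : Fin (k + 1), n j.rev = ∑ j, n j := Equiv.sum_comp Fin.revPerm n
  unfold integerCorrelator
  rw [h]
  split_ifs
  · simp
  · exact lorentzCorrelator_reflect b μ (α := fun j => (b : ℂ) * (n j : ℂ)) (by simp) _ q

/-! ### Hermiticity of the vacuum functional -/

theorem piCongrLeft_revPerm (k : ℕ) (u : Fin (k + 1) → ℝ × ℝ) :
    MeasurableEquiv.piCongrLeft (fun _ : Fin (k + 1) => ℝ × ℝ) Fin.revPerm u
      = fun j => u j.rev := by
  funext j
  simp [MeasurableEquiv.coe_piCongrLeft, Equiv.piCongrLeft_apply_eq_cast]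

theorem measurePreserving_rev (k : ℕ) :
    MeasureTheory.MeasurePreserving
      (MeasurableEquiv.piCongrLeft (fun _ : Fin (k + 1) => ℝ × ℝ) Fin.revPerm)
      (cylinderMeasure k) (cylinderMeasure k) := by
  have h := (MeasureTheory.volume_measurePreserving_piCongrLeft
    (fun _ : Fin (k + 1) => ℝ × ℝ) Fin.revPerm).restrict_preimage_emb
      (MeasurableEquiv.measurableEmbedding _)
      (Set.univ.pi fun _ => Set.univ ×ˢ Set.Icc (-1 : ℝ) 1)
  have hpre : MeasurableEquiv.piCongrLeft (fun _ : Fin (k + 1) => ℝ × ℝ) Fin.revPerm ⁻¹'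
      (Set.univ.pi fun _ => Set.univ ×ˢ Set.Icc (-1 : ℝ) 1)
      = Set.univ.pi fun _ => Set.univ ×ˢ Set.Icc (-1 : ℝ) 1 := by
    ext u
    rw [Set.mem_preimage, piCongrLeft_revPerm]
    simp only [Set.mem_pi, Set.mem_univ, true_implies]
    exact Equiv.forall_congr_right Fin.revPerm
      (q := fun j => u j ∈ Set.univ ×ˢ Set.Icc (-1 : ℝ) 1)
  rwa [hpre] at h

theorem smearedIntegrand_reflect (b μ : ℝ) {k : ℕ} (n : Fin (k + 1) → ℤ)
    (f : Fin (k + 1) → TestFunction) (u : Fin (k + 1) → ℝ × ℝ) :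
    smearedIntegrand b μ (fun j => n j.rev) (fun j => testConj (f j.rev)) (fun j => u j.rev)
      = starRingEnd ℂ (smearedIntegrand b μ n f u) := by
  rw [smearedIntegrand, smearedIntegrand, integerCorrelator_reflect, map_mul, map_prod]
  congr 1
  exact Equiv.prod_comp Fin.revPerm fun j => starRingEnd ℂ ((f j).1 (u j))

theorem testConj_testConj (f : TestFunction) : testConj (testConj f) = f :=
  Subtype.ext (funext fun _ => Complex.conj_conj _)

/-- This matches the two branches in the definition of `smearedVev`, so Hermiticity does not depend
on proving convergence. -/
theorem SmearingConverges.reflect {b μ : ℝ} {k : ℕ} {n : Fin (k + 1) → ℤ}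
    (h : SmearingConverges b μ n) : SmearingConverges b μ fun j => n j.rev := by
  intro f
  rw [← (measurePreserving_rev k).integrable_comp_emb (MeasurableEquiv.measurableEmbedding _)]
  have h1 := Complex.conjCLE.toContinuousLinearMap.integrable_comp
    (h fun j => testConj (f j.rev))
  refine h1.congr (Filter.Eventually.of_forall fun u => ?_)
  have h2 := smearedIntegrand_reflect b μ n (fun j => testConj (f j.rev)) u
  simp only [testConj_testConj, Fin.rev_rev] at h2
  simpa [piCongrLeft_revPerm] using h2.symm

theorem smearedVev_reflect (b μ : ℝ) {k : ℕ} (n : Fin (k + 1) → ℤ)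
    (f : Fin (k + 1) → TestFunction) :
    smearedVev b μ (fun j => n j.rev) (fun j => testConj (f j.rev))
      = starRingEnd ℂ (smearedVev b μ n f) := by
  by_cases h : SmearingConverges b μ n
  · rw [smearedVev_apply h, smearedVev_apply h.reflect, ← integral_conj,
      ← (measurePreserving_rev k).integral_comp (MeasurableEquiv.measurableEmbedding _)]
    refine MeasureTheory.integral_congr_ae (Filter.Eventually.of_forall fun u => ?_)
    simp only [piCongrLeft_revPerm]
    exact smearedIntegrand_reflect b μ n f u
  -- Reversal is an involution, so convergence fails on both sides and both values are 0 by
  -- convention.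
  · have h' : ¬ SmearingConverges b μ fun j => n j.rev := fun h' =>
      h (by simpa only [Fin.rev_rev] using h'.reflect)
    rw [smearedVev, smearedVev, dif_neg h, dif_neg h']
    simp

/-- Words in the basic observables span the algebra. -/
theorem span_obs_words (b : ℝ) :
    Submodule.span ℂ {A : ObsAlgebra b | ∃ l : List (TestFunction × ChargeIndex b),
      A = (l.map fun p => obs p.1 p.2).prod} = ⊤ := by
  have hadj : Algebra.adjoin ℂ
      (Set.range fun p : TestFunction × ChargeIndex b => obs p.1 p.2) = ⊤ := by
    rw [eq_top_iff, ← TensorAlgebra.adjoin_range_ι, Algebra.adjoin_le_iff]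
    rintro _ ⟨g, rfl⟩
    induction g using DirectSum.induction_on with
    | zero => simp
    | of n f => exact Algebra.subset_adjoin ⟨(f, n), rfl⟩
    | add g h hg hh => rw [map_add]; exact add_mem hg hh
  have h := Algebra.adjoin_eq_span ℂ
    (Set.range fun p : TestFunction × ChargeIndex b => obs (b := b) p.1 p.2)
  rw [hadj, Algebra.top_toSubmodule] at h
  rw [h]
  congr 1
  ext A
  constructor
  · rintro ⟨l, rfl⟩
    refine Submonoid.list_prod_mem _ fun x hx => ?_
    obtain ⟨p, -, rfl⟩ := List.mem_map.1 hx
    exact Submonoid.subset_closure ⟨p, rfl⟩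
  · intro hA
    induction hA using Submonoid.closure_induction with
    | mem x hx =>
      obtain ⟨p, rfl⟩ := hx
      exact ⟨[p], by simp⟩
    | one => exact ⟨[], rfl⟩
    | mul x y _ _ hx hy =>
      obtain ⟨l, rfl⟩ := hx
      obtain ⟨m, rfl⟩ := hy
      exact ⟨l ++ m, by simp⟩

/-- This reduces linear and conjugate-linear identities alike to words, since p need not come from a
linear map. -/
theorem obs_words_induction {b : ℝ} {p : ObsAlgebra b → Prop} (A : ObsAlgebra b)
    (word : ∀ l : List (TestFunction × ChargeIndex b), p (l.map fun x => obs x.1 x.2).prod)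
    (add : ∀ A B, p A → p B → p (A + B)) (smul : ∀ (c : ℂ) A, p A → p (c • A)) : p A := by
  have hA : A ∈ Submodule.span ℂ {A : ObsAlgebra b |
      ∃ l : List (TestFunction × ChargeIndex b), A = (l.map fun p => obs p.1 p.2).prod} := by
    rw [span_obs_words]; trivial
  induction hA using Submodule.span_induction with
  | mem x hx => obtain ⟨l, rfl⟩ := hx; exact word l
  | zero => simpa using smul 0 _ (word [])
  | add x y _ _ hx hy => exact add _ _ hx hy
  | smul c x _ hx => exact smul _ _ hx

theorem adj_word {b : ℝ} (l : List (TestFunction × ChargeIndex b)) :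
    adj (l.map fun p => obs p.1 p.2).prod
      = (l.reverse.map fun p => obs (testConj p.1) p.2).prod := by
  induction l with
  | nil => exact adj_one b
  | cons p l ih => simp [adj_mul, ih, adj_obs]

theorem adj_adj {b : ℝ} (A : ObsAlgebra b) : adj (adj A) = A := by
  induction A using obs_words_induction with
  | word l =>
    rw [adj_word]
    have := adj_word (b := b) (l.reverse.map fun p => (testConj p.1, p.2))
    simp only [List.map_map, Function.comp_def, ← List.map_reverse, List.reverse_reverse,
      testConj_testConj] at this
    exact this
  | add A B hA hB => rw [adj_add, adj_add, hA, hB]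
  | smul c A hA => rw [adj_smul, adj_smul, hA, Complex.conj_conj]

theorem vacuum_adj_word (b μ : ℝ) {k : ℕ} (f : Fin k → TestFunction) (n : Fin k → ChargeIndex b) :
    vacuum b μ (List.ofFn fun j => obs (testConj (f j.rev)) (n j.rev)).prod
      = starRingEnd ℂ (vacuum b μ (List.ofFn fun j => obs (f j) (n j)).prod) := by
  cases k with
  | zero => simp [vacuum_one]
  | succ k =>
    rw [vacuum_monomial b μ k f n, ← smearedVev_reflect]
    exact vacuum_monomial b μ k (fun j => testConj (f j.rev)) fun j => n j.rev

/-- The vacuum functional is Hermitian. -/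
theorem vacuum_adj (b μ : ℝ) (A : ObsAlgebra b) :
    vacuum b μ (adj A) = starRingEnd ℂ (vacuum b μ A) := by
  induction A using obs_words_induction with
  | word l =>
    have h := vacuum_adj_word b μ (fun j => (l.get j).1) fun j => (l.get j).2
    have h1 : (List.ofFn fun j => obs (b := b) (l.get j).1 (l.get j).2)
        = l.map fun p => obs p.1 p.2 := by
      conv_rhs => rw [← List.ofFn_get l, List.map_ofFn]
      rfl
    have h2 : (List.ofFn fun j : Fin l.length =>
        obs (b := b) (testConj (l.get j.rev).1) (l.get j.rev).2)
        = l.reverse.map fun p => obs (testConj p.1) p.2 := by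
      refine List.ext_getElem (by simp) fun i _ _ => ?_
      simp [Fin.rev, Nat.sub_sub, add_comm]
    rwa [h1, h2, ← adj_word] at h
  | add A B hA hB => rw [adj_add, map_add, map_add, hA, hB, map_add]
  | smul c A hA => rw [adj_smul, map_smul, map_smul, hA, smul_eq_mul, smul_eq_mul, map_mul]

/-! ### The state space -/

/-- The coordinate `z ↦ z_A` of `ℂ^𝒜`. -/
def coordinate {b : ℝ} (A : ObsAlgebra b) : (ObsAlgebra b → ℂ) →ₗ[ℂ] ℂ := LinearMap.proj A

@[simp] theorem coordinate_apply {b : ℝ} (A : ObsAlgebra b) (z : ObsAlgebra b → ℂ) :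
    coordinate A z = z A := rfl

theorem Phi_apply (b μ : ℝ) (A B : ObsAlgebra b) : Phi b μ A B = vacuum b μ (adj B * A) := rfl

/-- Apply Hermiticity to (A^* B)^* = B^* A. This trades the coordinate index for the vector. -/
theorem Phi_conj_symm (b μ : ℝ) (A B : ObsAlgebra b) :
    Phi b μ A B = starRingEnd ℂ (Phi b μ B A) := by
  rw [Phi_apply, Phi_apply, ← vacuum_adj, adj_mul, adj_adj]

/-- A closed linear condition on `ℂ^𝒜` that holds on all the `Φ(C)` holds on `ℋ`. -/
theorem stateSpace_le_ker {b μ : ℝ} {L : (ObsAlgebra b → ℂ) →ₗ[ℂ] ℂ} (hL : Continuous L)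
    (h : ∀ C, L (Phi b μ C) = 0) (z : stateSpace b μ) : L z.1 = 0 := by
  have hle : stateCore b μ ≤ L.ker := by
    rintro _ ⟨C, rfl⟩
    exact h C
  exact Submodule.topologicalClosure_minimal _ hle (isClosed_singleton.preimage hL) z.2

/-- On Φ(C) the coordinates A and A' are the conjugates of Φ(A)_C and Φ(A')_C. Their difference is
continuous in the product topology, so it vanishes on the closure. -/
theorem stateSpace_eval_eq {b μ : ℝ} {A A' : ObsAlgebra b} (h : Phi b μ A = Phi b μ A')
    (z : stateSpace b μ) : z.1 A = z.1 A' := by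
  have hL : Continuous (coordinate A - coordinate A') := by
    change Continuous fun z : ObsAlgebra b → ℂ => z A - z A'
    fun_prop
  refine sub_eq_zero.1 (stateSpace_le_ker (μ := μ) hL (fun C => ?_) z)
  rw [LinearMap.sub_apply, coordinate_apply, coordinate_apply, Phi_conj_symm b μ C A,
    Phi_conj_symm b μ C A', h, sub_self]

theorem stateSpace_eval_add {b μ : ℝ} (A B : ObsAlgebra b) (z : stateSpace b μ) :
    z.1 (A + B) = z.1 A + z.1 B := by
  have hL : Continuous (coordinate (A + B) - (coordinate A + coordinate B)) := by
    change Continuous fun z : ObsAlgebra b → ℂ => z (A + B) - (z A + z B)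
    fun_prop
  refine sub_eq_zero.1 (stateSpace_le_ker (μ := μ) hL (fun C => ?_) z)
  simp [Phi_apply, adj_add, add_mul]

theorem stateSpace_eval_smul {b μ : ℝ} (c : ℂ) (A : ObsAlgebra b) (z : stateSpace b μ) :
    z.1 (c • A) = starRingEnd ℂ c * z.1 A := by
  have hL : Continuous (coordinate (c • A) - starRingEnd ℂ c • coordinate A) := by
    change Continuous fun z : ObsAlgebra b → ℂ => z (c • A) - starRingEnd ℂ c • z A
    fun_prop
  refine sub_eq_zero.1 (stateSpace_le_ker (μ := μ) hL (fun C => ?_) z)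
  simp [Phi_apply, adj_smul]

theorem Phi_choose {b μ : ℝ} (u : stateCore b μ) : Phi b μ u.2.choose = u.1 := u.2.choose_spec

/-- The pairing `(Φ(A), z) = z_A` of `ℋ₀` with `ℋ`. -/
noncomputable def statePairing (b μ : ℝ) : stateCore b μ →ₗ⋆[ℂ] stateSpace b μ →ₗ[ℂ] ℂ :=
  -- An arbitrary representative of u is chosen; `stateSpace_eval_eq` makes the value independent of
  -- it.
  LinearMap.mk₂'ₛₗ (starRingEnd ℂ) (RingHom.id ℂ) (fun u z => z.1 u.2.choose)
    (fun u v z => by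
      rw [← stateSpace_eval_add]
      refine stateSpace_eval_eq ?_ z
      rw [map_add, Phi_choose, Phi_choose, Phi_choose]
      rfl)
    (fun c u z => by
      rw [smul_eq_mul, ← stateSpace_eval_smul]
      refine stateSpace_eval_eq ?_ z
      rw [map_smul, Phi_choose, Phi_choose]
      rfl)
    (fun _ _ _ => rfl) (fun _ _ _ => rfl)

theorem statePairing_coreVec (b μ : ℝ) (A : ObsAlgebra b) (z : stateSpace b μ) :
    statePairing b μ (coreVec b μ A) z = z.1 A :=
  stateSpace_eval_eq (Phi_choose (coreVec b μ A)) z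

theorem exists_coreVec_eq {b μ : ℝ} (u : stateCore b μ) : ∃ A, coreVec b μ A = u := by
  obtain ⟨_, A, rfl⟩ := u
  exact ⟨A, rfl⟩

theorem denseRange_coreIncl (b μ : ℝ) : DenseRange (coreIncl b μ) := by
  intro z
  rw [Topology.IsInducing.subtypeVal.closure_eq_preimage_closure_image, Set.mem_preimage]
  have h : Subtype.val '' Set.range (coreIncl b μ) = (stateCore b μ : Set (ObsAlgebra b → ℂ)) := by
    ext x
    constructor
    · rintro ⟨_, ⟨u, rfl⟩, rfl⟩
      exact u.2
    · exact fun hx => ⟨_, ⟨⟨x, hx⟩, rfl⟩, rfl⟩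
  exact (congrArg (fun S => z.1 ∈ closure S) h).mpr z.2

end TimelikeLiouville

theorem theorem2p9 (b μ : ℝ) (hb : 0 < b) (hb' : b < 1 / Real.sqrt 2) (hμ : 0 < μ) :
    -- `ℋ₀` is dense in `ℋ`
    DenseRange (coreIncl b μ) ∧
    -- `z_A` depends only on `Φ(A)`, for `z ∈ ℋ`
    (∀ A A' : ObsAlgebra b, Phi b μ A = Phi b μ A' →
      ∀ z : stateSpace b μ, z.1 A = z.1 A') ∧
    -- there is a unique pairing `(Φ(A), z) = z_A`; it is conjugate linear in the first argument and
    -- linear in the second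
    (∃! P : stateCore b μ →ₗ⋆[ℂ] stateSpace b μ →ₗ[ℂ] ℂ,
      ∀ (A : ObsAlgebra b) (z : stateSpace b μ), P (coreVec b μ A) z = z.1 A) ∧
    ∀ P : stateCore b μ →ₗ⋆[ℂ] stateSpace b μ →ₗ[ℂ] ℂ,
      (∀ (A : ObsAlgebra b) (z : stateSpace b μ), P (coreVec b μ A) z = z.1 A) →
        -- it recovers the algebraic form
        (∀ A B : ObsAlgebra b,
          P (coreVec b μ A) (coreIncl b μ (coreVec b μ B)) = algForm b μ A B) ∧
        -- its restriction to `ℋ₀` is Hermitian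
        (∀ u v : stateCore b μ,
          P u (coreIncl b μ v) = starRingEnd ℂ (P v (coreIncl b μ u))) ∧
        -- its restriction to `ℋ₀` is nondegenerate, in each argument
        (∀ v : stateCore b μ, (∀ u : stateCore b μ, P u (coreIncl b μ v) = 0) → v = 0) ∧
        (∀ u : stateCore b μ, (∀ v : stateCore b μ, P u (coreIncl b μ v) = 0) → u = 0) ∧
        -- it separates the points of `ℋ`
        (∀ z : stateSpace b μ, (∀ u : stateCore b μ, P u z = 0) → z = 0) := by
  refine ⟨denseRange_coreIncl b μ, fun A A' h z => stateSpace_eval_eq h z,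
    ⟨statePairing b μ, statePairing_coreVec b μ, fun P hP => ?_⟩, fun P hP => ?_⟩
  · ext u z
    obtain ⟨A, rfl⟩ := exists_coreVec_eq u
    rw [hP, statePairing_coreVec]
  have hform (A B : ObsAlgebra b) :
      P (coreVec b μ A) (coreIncl b μ (coreVec b μ B)) = algForm b μ A B := hP A _
  have hherm (u v : stateCore b μ) :
      P u (coreIncl b μ v) = starRingEnd ℂ (P v (coreIncl b μ u)) := by
    obtain ⟨A, rfl⟩ := exists_coreVec_eq u
    obtain ⟨B, rfl⟩ := exists_coreVec_eq v
    rw [hform, hform]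
    exact Phi_conj_symm b μ B A
  -- Every coordinate z_A is a value of the pairing. Nondegeneracy in the second argument is the
  -- case z ∈ ℋ₀; Hermiticity then gives the first.
  have hsep (z : stateSpace b μ) (hz : ∀ u : stateCore b μ, P u z = 0) : z = 0 :=
    Subtype.ext (funext fun A => (hP A z).symm.trans (hz _))
  have hright (v : stateCore b μ) (hv : ∀ u : stateCore b μ, P u (coreIncl b μ v) = 0) : v = 0 :=
    Submodule.inclusion_injective _ ((hsep _ hv).trans (map_zero (coreIncl b μ)).symm)
  refine ⟨hform, hherm, hright, fun u hu => hright u fun v => ?_, hsep⟩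
  rw [hherm, hu, map_zero]
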